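/- **Theorem.** The class of symmetric groups $S_n$ is logarithmically compressible (LC). Here the language of groups has symbols for multiplication, inversion and the identity, together with equality, and the length $|\psi|$ of a first-order formula $\psi$ is the number of occurrences of symbols in it, where each occurrence of a variable counts as one symbol (there are infinitely many variables). A class $\mathcal C$ of finite groups is LC if for each $H\in\mathcal C$ there is a first-order sentence $\psi_H$ in the language of groups such that $H\models\psi_H$, every group $G$ (finite or infinite) with $G\models\psi_H$ is isomorphic to $H$, and $|\psi_H| = O(\log|H|)$. Explicitly: there is a constant $C$ such that for every $n\ge 0$ there is a first-order sentence $\psi_n$ in the language of groups such that $S_n\models\psi_n$, every group $G$ with $G\models\psi_n$ is isomorphic to $S_n$, and, if $n\ge 2$, $|\psi_n|\le C\log|S_n| = C\log(n!)$. -/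

import Mathlib

open scoped FirstOrder

universe u v w

/-- The length of a first-order term: the number of occurrences of symbols in it (in Polish
notation), every occurrence of a variable being a single symbol. -/
def termLength {L : FirstOrder.Language.{u, v}} {α : Type w} : L.Term α → ℕ
  | .var _ => 1
  | .func _ ts => 1 + ∑ i, termLength (ts i)

/-- The length of a first-order formula: the number of occurrences of symbols in it (in Polish
notation, so that parentheses are not needed). Every occurrence of a variable is one symbol, and a
quantifier together with the variable that it binds consists of two symbols. The primitive logical
symbols are `⊥`, `=`, `→`, `∀`; replacing each of `¬`, `∧`, `∨`, `∃` by its usual definition from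
these changes the length by at most a constant factor. -/
def formulaLength {L : FirstOrder.Language.{u, v}} {α : Type w} : {n : ℕ} → L.BoundedFormula α n → ℕ
  | _, .falsum => 1
  | _, .equal t₁ t₂ => 1 + termLength t₁ + termLength t₂
  | _, .rel _ ts => 1 + ∑ i, termLength (ts i)
  | _, .imp φ ψ => 1 + formulaLength φ + formulaLength ψ
  | _, .all φ => 2 + formulaLength φ

/-- The operation symbols of the language of groups. -/
inductive GroupFunc : ℕ → Type
  | one : GroupFunc 0
  | inv : GroupFunc 1
  | mul : GroupFunc 2

/-- The first-order language of groups: symbols for the identity, inversion and multiplication,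
and no relation symbol besides equality. -/
def groupLanguage : FirstOrder.Language.{0, 0} where
  Functions := GroupFunc
  Relations := fun _ => Empty

/-- Every group is a structure for the language of groups in the standard way. -/
instance groupStructure (G : Type u) [Group G] : groupLanguage.Structure G where
  funMap {_} f := match f with
    | .one => fun _ => 1
    | .inv => fun x => (x 0)⁻¹
    | .mul => fun x => x 0 * x 1
  RelMap {_} r := Empty.elim r

/-- The sentence `ψ` describes the group `H`: it holds in `H`, and every group in which it holds is
isomorphic to `H`. -/
def DescribesGroup (ψ : groupLanguage.Sentence) (H : Type u) [Group H] : Prop :=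
  H ⊨ ψ ∧ ∀ (G : Type u) [Group G], G ⊨ ψ → Nonempty (G ≃* H)

/-- `𝒞` is a class of finite groups, and every group `H` in `𝒞` is described by a first-order
sentence `ψ` of length `O((log |H|) ^ k)`, the implied constant depending only on `𝒞` and `k`.
The bound on the length is not asked for when `|H| = 1`, where `log |H| = 0`. -/
def PolylogCompressibleWithExponent (k : ℕ) (𝒞 : (G : Type u) → [Group G] → Prop) : Prop :=
  (∀ (H : Type u) [Group H], 𝒞 H → Finite H) ∧
    ∃ C : ℝ, ∀ (H : Type u) [Group H], 𝒞 H →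
      ∃ ψ : groupLanguage.Sentence, DescribesGroup ψ H ∧
        (1 < Nat.card H → (formulaLength ψ : ℝ) ≤ C * Real.log (Nat.card H) ^ k)

/-- A class of finite groups is logarithmically compressible (LC) if each group `H` in it is
described by a first-order sentence of length `O(log |H|)`. -/
def LogCompressible (𝒞 : (G : Type u) → [Group G] → Prop) : Prop :=
  PolylogCompressibleWithExponent 1 𝒞

/-- The class of the symmetric groups `S_n`, `n = 0, 1, 2, …` (up to isomorphism). -/
def IsSymmetricGroup (G : Type u) [Group G] : Prop :=
  ∃ n : ℕ, Nonempty (G ≃* Equiv.Perm (Fin n))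

/-! Write `n = m + 1` with `m ≥ 2`. In `S_n` let `A` be the star of the `m` transpositions moving a
base point. An `m`-cycle `c` fixing that point carries one of them, `a`, through all of `A`, so "`t
∈ A`" is expressed recursively ("`t = a`, or `t` is the `c`-conjugate of an earlier element") in
length `O(m)`. The setwise normalizer `N` of `A` is then definable too, and in `S_n` it is the
stabilizer of the base point (`mem_setwiseNormalizer_cyclePerm`).

Conversely, the axioms `IsTranspositionStar` force `G ≅ S_n`
(`IsTranspositionStar.nonempty_mulEquiv`): `1` and the `m` distinct elements of `A` represent the
cosets of `N`, the action on `G ⧸ N` is faithful, and each `x ∈ A` acts as the transposition of the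
cosets of `1` and `x`. Such transpositions generate the full symmetric group.

The sentence has length `O(m)`, while `log (n!) ≥ m log 2`. Degrees at most 2 have their own
sentences. -/

open FirstOrder.Language

/-! ### Terms and formulas in the language of groups -/

section TermsAndFormulas

variable {α : Type} {G : Type u} [Group G]

/-- The product of two terms. -/
def mulTerm (s t : groupLanguage.Term α) : groupLanguage.Term α :=
  .func (l := 2) GroupFunc.mul ![s, t]

/-- The inverse of a term. -/
def invTerm (t : groupLanguage.Term α) : groupLanguage.Term α :=
  .func (l := 1) GroupFunc.inv ![t]

/-- The identity element as a term. -/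
def oneTerm : groupLanguage.Term α :=
  .func (l := 0) GroupFunc.one ![]

/-- The conjugate `s t s⁻¹` as a term. -/
def conjTerm (s t : groupLanguage.Term α) : groupLanguage.Term α :=
  mulTerm (mulTerm s t) (invTerm s)

/-- A term in which one more variable is allowed. -/
def liftTerm {k : ℕ} (t : groupLanguage.Term (Empty ⊕ Fin k)) :
    groupLanguage.Term (Empty ⊕ Fin (k + 1)) :=
  t.relabel (Sum.map id Fin.castSucc)

@[simp] lemma realize_mulTerm (v : α → G) (s t : groupLanguage.Term α) :
    (mulTerm s t).realize v = s.realize v * t.realize v := rfl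

@[simp] lemma realize_oneTerm (v : α → G) : (oneTerm : groupLanguage.Term α).realize v = 1 := rfl

@[simp] lemma realize_conjTerm (v : α → G) (s t : groupLanguage.Term α) :
    (conjTerm s t).realize v = s.realize v * t.realize v * (s.realize v)⁻¹ := rfl

@[simp] lemma realize_liftTerm {k : ℕ} (t : groupLanguage.Term (Empty ⊕ Fin k))
    (v : Empty → G) (xs : Fin k → G) (y : G) :
    (liftTerm t).realize (Sum.elim v (Fin.snoc xs y)) = t.realize (Sum.elim v xs) := by
  rw [liftTerm, Term.realize_relabel]
  congr 1
  ext x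
  rcases x with x | x <;> simp

@[simp] lemma termLength_var (x : α) :
    termLength (Term.var x : groupLanguage.Term α) = 1 := by simp [termLength]

@[simp] lemma termLength_mulTerm (s t : groupLanguage.Term α) :
    termLength (mulTerm s t) = 1 + (termLength s + termLength t) := by
  simp [mulTerm, termLength, Fin.sum_univ_two]

@[simp] lemma termLength_invTerm (t : groupLanguage.Term α) :
    termLength (invTerm t) = 1 + termLength t := by
  simp [invTerm, termLength]

@[simp] lemma termLength_oneTerm : termLength (oneTerm : groupLanguage.Term α) = 1 := by
  simp [oneTerm, termLength]

@[simp] lemma termLength_conjTerm (s t : groupLanguage.Term α) :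
    termLength (conjTerm s t) = 3 + 2 * termLength s + termLength t := by
  simp [conjTerm]; ring

lemma termLength_relabel {β : Type} (f : α → β) (t : groupLanguage.Term α) :
    termLength (t.relabel f) = termLength t := by
  induction t with
  | var x => simp [termLength]
  | func g ts ih => simp [termLength, ih]

@[simp] lemma termLength_liftTerm {k : ℕ} (t : groupLanguage.Term (Empty ⊕ Fin k)) :
    termLength (liftTerm t) = termLength t := termLength_relabel _ t

variable {k : ℕ} (φ ψ : groupLanguage.BoundedFormula α k)

@[simp] lemma formulaLength_imp :
    formulaLength (φ.imp ψ) = 1 + formulaLength φ + formulaLength ψ := by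
  simp [formulaLength]

@[simp] lemma formulaLength_not : formulaLength φ.not = 2 + formulaLength φ := by
  change 1 + formulaLength φ + 1 = _
  ring

@[simp] lemma formulaLength_inf :
    formulaLength (φ ⊓ ψ) = 5 + formulaLength φ + formulaLength ψ := by
  change formulaLength (φ.imp ψ.not).not = _
  simp; ring

@[simp] lemma formulaLength_sup :
    formulaLength (φ ⊔ ψ) = 3 + formulaLength φ + formulaLength ψ := by
  change formulaLength (φ.not.imp ψ) = _
  simp; ring

@[simp] lemma formulaLength_iff :
    formulaLength (φ.iff ψ) = 7 + 2 * formulaLength φ + 2 * formulaLength ψ := by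
  simp [BoundedFormula.iff]; ring

@[simp] lemma formulaLength_all (φ : groupLanguage.BoundedFormula α (k + 1)) :
    formulaLength φ.all = 2 + formulaLength φ := by
  simp [formulaLength]

@[simp] lemma formulaLength_ex (φ : groupLanguage.BoundedFormula α (k + 1)) :
    formulaLength φ.ex = 6 + formulaLength φ := by
  simp [BoundedFormula.ex]; ring

@[simp] lemma formulaLength_bdEqual (s t : groupLanguage.Term (α ⊕ Fin k)) :
    formulaLength (s.bdEqual t) = 1 + termLength s + termLength t := by
  simp [Term.bdEqual, formulaLength]

end TermsAndFormulas

/-! ### The sentence describing a symmetric group -/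

/-- With the first two variables standing for `c` and `a`, the formula expressing that `t` is one
of the conjugates `c ^ i * a * c ^ (-i)` with `i ≤ j`. -/
def starFormula : (j k : ℕ) → groupLanguage.Term (Empty ⊕ Fin (k + 2)) →
    groupLanguage.BoundedFormula Empty (k + 2)
  | 0, _, t => t =' &1
  | j + 1, k, t =>
    -- The recursive call is made once, on a fresh variable, so each level costs a constant number
    -- of symbols; writing out all `c ^ i * a * c ^ (-i)` would cost quadratically many.
    (t =' &1) ⊔ ∃' (starFormula j (k + 1) (&(Fin.last (k + 2))) ⊓
      (liftTerm t =' conjTerm (&0) (&(Fin.last (k + 2)))))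

/-- The formula expressing that `t` normalizes the set defined by `starFormula j`. -/
def starNormalizerFormula (j k : ℕ) (t : groupLanguage.Term (Empty ⊕ Fin (k + 2))) :
    groupLanguage.BoundedFormula Empty (k + 2) :=
  ∀' ((starFormula j (k + 1) (&(Fin.last (k + 2)))).iff
    (starFormula j (k + 1) (conjTerm (liftTerm t) (&(Fin.last (k + 2))))))

/-- The sentence describing the symmetric group of degree `q + 3`. -/
def symmetricSentence (q : ℕ) : groupLanguage.Sentence :=
  ∃' ∃' (
    -- The conjuncts are the fields of `IsTranspositionStar` for `m = q + 2`; index `q + 1` allows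
    -- the exponents `0, …, q + 1`.
    (∀' (starNormalizerFormula (q + 1) 1 (&2) ⊔
      ∃' (starFormula (q + 1) 2 (&3) ⊓ starNormalizerFormula (q + 1) 2 (mulTerm (&3) (&2))))) ⊓
    ((∀' ∀' (starFormula (q + 1) 2 (&2) ⟹ (starFormula (q + 1) 2 (&3) ⟹
      (∼(&2 =' &3) ⟹ starNormalizerFormula (q + 1) 2 (mulTerm (mulTerm (&2) (&3)) (&2)))))) ⊓
    ((∀' (starFormula (q + 1) 1 (&2) ⟹
      ((mulTerm (&2) (&2) =' oneTerm) ⊓ ∼(starNormalizerFormula (q + 1) 1 (&2))))) ⊓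
    ((∀' ((∀' starNormalizerFormula (q + 1) 2 (conjTerm (&3) (&2))) ⟹ (&2 =' oneTerm))) ⊓
    -- Index `q` here: only the first `m - 1` conjugates, since the next step of the cycle does
    -- return to `a`.
    (∀' (starFormula q 1 (&2) ⟹ ∼(conjTerm (&0) (&2) =' &1)))))))

lemma formulaLength_starFormula_le (j k : ℕ) (t : groupLanguage.Term (Empty ⊕ Fin (k + 2))) :
    formulaLength (starFormula j k t) ≤ 2 * termLength t + 30 * (j + 1) := by
  induction j generalizing k with
  | zero => simp [starFormula]; omega
  | succ j ih =>
    have := ih (k + 1) (&(Fin.last (k + 2)))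
    simp [starFormula] at this ⊢
    omega

lemma formulaLength_starNormalizerFormula_le (j k : ℕ)
    (t : groupLanguage.Term (Empty ⊕ Fin (k + 2))) :
    formulaLength (starNormalizerFormula j k t) ≤ 8 * termLength t + 160 * (j + 1) := by
  have h₁ := formulaLength_starFormula_le j (k + 1) (&(Fin.last (k + 2)))
  have h₂ := formulaLength_starFormula_le j (k + 1)
    (conjTerm (liftTerm t) (&(Fin.last (k + 2))))
  simp [starNormalizerFormula] at h₁ h₂ ⊢
  omega

lemma formulaLength_symmetricSentence_le (q : ℕ) :
    formulaLength (symmetricSentence q) ≤ 2000 * (q + 2) := by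
  have hs := formulaLength_starFormula_le (q + 1)
  have hn := formulaLength_starNormalizerFormula_le (q + 1)
  have h₁ := hn 1 (&2)
  have h₂ := hs 2 (&3)
  have h₃ := hn 2 (mulTerm (&3) (&2))
  have h₄ := hs 2 (&2)
  have h₅ := hn 2 (mulTerm (mulTerm (&2) (&3)) (&2))
  have h₆ := hs 1 (&2)
  have h₇ := hn 2 (conjTerm (&3) (&2))
  have h₈ := formulaLength_starFormula_le q 1 (&2)
  simp [symmetricSentence] at *
  omega

/-! ### The meaning of the sentence -/

lemma snoc_one {M : Type u} {k : ℕ} (xs : Fin (k + 2) → M) (y : M) :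
    (Fin.snoc xs y : Fin (k + 3) → M) 1 = xs 1 :=
  Fin.snoc_castSucc (α := fun _ => M) y xs 1

section Semantics

variable {G : Type u} [Group G]

/-- The conjugates of `a` by the first `m` powers of `c`. -/
def starSet (c a : G) (m : ℕ) : Set G := {x | ∃ i < m, x = c ^ i * a * (c ^ i)⁻¹}

/-- The elements normalizing a subset of a group. -/
def setwiseNormalizer (A : Set G) : Subgroup G where
  -- An equivalence rather than one inclusion, so that inverses remain inside for infinite `A` as
  -- well.
  carrier := {g | ∀ x, x ∈ A ↔ g * x * g⁻¹ ∈ A}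
  one_mem' x := by simp
  mul_mem' {g h} hg hh x := by
    rw [hh x, hg (h * x * h⁻¹)]
    simp [mul_assoc]
  inv_mem' {g} hg x := by
    rw [hg (g⁻¹ * x * g⁻¹⁻¹)]
    simp [mul_assoc]

lemma mem_setwiseNormalizer {A : Set G} {g : G} :
    g ∈ setwiseNormalizer A ↔ ∀ x, x ∈ A ↔ g * x * g⁻¹ ∈ A := Iff.rfl

/-- The set of the conjugates of `a` by the first `m` powers of `c` behaves like the set of the
`m` transpositions that move a given point. -/
structure IsTranspositionStar (m : ℕ) (c a : G) : Prop where
  exists_mul_mem : ∀ g, g ∈ setwiseNormalizer (starSet c a m) ∨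
    ∃ x ∈ starSet c a m, x * g ∈ setwiseNormalizer (starSet c a m)
  mul_mul_mem : ∀ x y, x ∈ starSet c a m → y ∈ starSet c a m → x ≠ y →
    x * y * x ∈ setwiseNormalizer (starSet c a m)
  mul_self_and_notMem : ∀ x ∈ starSet c a m,
    x * x = 1 ∧ x ∉ setwiseNormalizer (starSet c a m)
  -- The normal core of the normalizer is trivial, which makes the coset action faithful.
  eq_one : ∀ h, (∀ g, g * h * g⁻¹ ∈ setwiseNormalizer (starSet c a m)) → h = 1
  conj_ne : ∀ x ∈ starSet c a (m - 1), c * x * c⁻¹ ≠ a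

lemma mem_starSet_succ {c a x : G} {m : ℕ} :
    x ∈ starSet c a (m + 1) ↔ x = a ∨ ∃ y ∈ starSet c a m, x = c * y * c⁻¹ := by
  constructor
  · rintro ⟨_ | i, hi, rfl⟩
    · simp
    · exact .inr ⟨_, ⟨i, by omega, rfl⟩, by simp [pow_succ', mul_assoc]⟩
  · rintro (rfl | ⟨_, ⟨i, hi, rfl⟩, rfl⟩)
    · exact ⟨0, by omega, by simp⟩
    · exact ⟨i + 1, by omega, by simp [pow_succ', mul_assoc]⟩

lemma realize_starFormula (j k : ℕ) (t : groupLanguage.Term (Empty ⊕ Fin (k + 2)))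
    (v : Empty → G) (xs : Fin (k + 2) → G) :
    (starFormula j k t).Realize v xs ↔
      t.realize (Sum.elim v xs) ∈ starSet (xs 0) (xs 1) (j + 1) := by
  induction j generalizing k with
  | zero =>
    simp [starFormula, starSet]
  | succ j ih =>
    rw [mem_starSet_succ]
    simp [starFormula, ih, snoc_one]

lemma realize_starNormalizerFormula (j k : ℕ) (t : groupLanguage.Term (Empty ⊕ Fin (k + 2)))
    (v : Empty → G) (xs : Fin (k + 2) → G) :
    (starNormalizerFormula j k t).Realize v xs ↔
      t.realize (Sum.elim v xs) ∈ setwiseNormalizer (starSet (xs 0) (xs 1) (j + 1)) := by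
  simp [starNormalizerFormula, realize_starFormula, snoc_one, mem_setwiseNormalizer]

lemma realize_symmetricSentence (q : ℕ) :
    G ⊨ symmetricSentence q ↔ ∃ c a : G, IsTranspositionStar (q + 2) c a := by
  have h₁ (xs : Fin 1 → G) (x : G) : (Fin.snoc xs x : Fin 2 → G) 1 = x := rfl
  have h₂ (xs : Fin 2 → G) (x : G) : (Fin.snoc xs x : Fin 3 → G) 1 = xs 1 := rfl
  have h₃ (xs : Fin 3 → G) (x : G) : (Fin.snoc xs x : Fin 4 → G) 1 = xs 1 := rfl
  simp only [FirstOrder.Language.Sentence.Realize, FirstOrder.Language.Formula.Realize,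
    symmetricSentence, BoundedFormula.realize_ex, BoundedFormula.realize_inf,
    BoundedFormula.realize_all, BoundedFormula.realize_sup, BoundedFormula.realize_imp,
    BoundedFormula.realize_not, BoundedFormula.realize_bdEqual, realize_starFormula,
    realize_starNormalizerFormula, h₁, h₂, h₃, realize_mulTerm, realize_conjTerm, realize_oneTerm]
  refine exists_congr fun c => exists_congr fun a => ⟨?_, ?_⟩
  · rintro ⟨h₁, h₂, h₃, h₄, h₅⟩
    exact ⟨h₁, h₂, h₃, h₄, h₅⟩
  · rintro ⟨h₁, h₂, h₃, h₄, h₅⟩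
    exact ⟨h₁, h₂, h₃, h₄, h₅⟩

end Semantics

/-! ### Groups satisfying the sentence are symmetric -/

section Recognition

variable {G : Type u} [Group G]

lemma IsTranspositionStar.nonempty_mulEquiv {m : ℕ} {c a : G} (h : IsTranspositionStar m c a) :
    Nonempty (G ≃* Equiv.Perm (Fin (m + 1))) := by
  classical
  set A := starSet c a m
  set N := setwiseNormalizer A
  have hinv : ∀ x ∈ A, x⁻¹ = x := fun x hx =>
    inv_eq_of_mul_eq_one_left (h.mul_self_and_notMem x hx).1
  have hrep : ∀ p : G ⧸ N, p = (1 : G) ∨ ∃ x ∈ A, p = (x : G) := by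
    intro p
    induction p using QuotientGroup.induction_on with
    | H g =>
      rcases h.exists_mul_mem g with hg | ⟨x, hx, hg⟩
      · left
        rw [eq_comm, QuotientGroup.eq]
        simpa using hg
      · refine .inr ⟨x, hx, ?_⟩
        rw [eq_comm, QuotientGroup.eq, hinv x hx]
        exact hg
  have hne : ∀ x ∈ A, ((1 : G) : G ⧸ N) ≠ (x : G) := by
    intro x hx e
    rw [QuotientGroup.eq] at e
    exact (h.mul_self_and_notMem x hx).2 (by simpa using e)
  have hinj : ∀ x ∈ A, ∀ y ∈ A, ((x : G) : G ⧸ N) = (y : G) → x = y := by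
    intro x hx y hy e
    by_contra hxy
    rw [QuotientGroup.eq, hinv x hx] at e
    -- Equal cosets put `x * y` in `N`; with `x * y * x ∈ N` this gives `x = (x * y)⁻¹ * (x * y * x)
    -- ∈ N`, which is excluded.
    have h₁ := N.mul_mem (N.inv_mem e) (h.mul_mul_mem x y hx hy hxy)
    simp only [mul_inv_rev, hinv x hx, hinv y hy] at h₁
    have h₂ : y * x * (x * y * x) = x := by
      have hx' := (h.mul_self_and_notMem x hx).1
      have hy' := (h.mul_self_and_notMem y hy).1
      calc y * x * (x * y * x) = y * (x * x) * y * x := by group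
        _ = x := by rw [hx', mul_one, hy', one_mul]
    rw [h₂] at h₁
    exact (h.mul_self_and_notMem x hx).2 h₁
  have hpow : ∀ i j : ℕ, i < j → j < m → c ^ i * a * (c ^ i)⁻¹ ≠ c ^ j * a * (c ^ j)⁻¹ := by
    intro i j hij hj e
    obtain ⟨d, rfl⟩ : ∃ d, j = i + (d + 1) := ⟨j - i - 1, by omega⟩
    -- Cancelling `c ^ i` makes `a` its own conjugate by `c ^ (d + 1)`, with `d + 1 < m`.
    refine h.conj_ne _ ⟨d, by omega, rfl⟩ ?_
    rw [pow_add c i] at e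
    have : a = c ^ (d + 1) * a * (c ^ (d + 1))⁻¹ := by
      have := congrArg (fun z => (c ^ i)⁻¹ * z * c ^ i) e
      simpa [mul_assoc] using this
    rw [pow_succ'] at this
    conv_rhs => rw [this]
    group
  let f : Option (Fin m) → G ⧸ N := fun o =>
    o.elim ((1 : G) : G ⧸ N) fun i => ((c ^ (i : ℕ) * a * (c ^ (i : ℕ))⁻¹ : G) : G ⧸ N)
  have hmem : ∀ i : Fin m, c ^ (i : ℕ) * a * (c ^ (i : ℕ))⁻¹ ∈ A := fun i => ⟨i, i.2, rfl⟩
  have hf : Function.Bijective f := by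
    constructor
    · rintro (_ | i) (_ | j) e
      · rfl
      · exact absurd e (hne _ (hmem j))
      · exact absurd e.symm (hne _ (hmem i))
      · have := hinj _ (hmem i) _ (hmem j) e
        rcases lt_trichotomy (i : ℕ) j with hij | hij | hij
        · exact absurd this (hpow _ _ hij j.2)
        · rw [Fin.ext hij]
        · exact absurd this.symm (hpow _ _ hij i.2)
    · intro p
      rcases hrep p with rfl | ⟨_, ⟨i, hi, rfl⟩, rfl⟩
      · exact ⟨none, rfl⟩
      · exact ⟨some ⟨i, hi⟩, rfl⟩
  let e : Option (Fin m) ≃ G ⧸ N := Equiv.ofBijective f hf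
  have : Finite (G ⧸ N) := Finite.of_equiv _ e
  let ρ := MulAction.toPermHom G (G ⧸ N)
  have hρ : ∀ g y : G, ρ g (y : G ⧸ N) = ((g * y : G) : G ⧸ N) := fun _ _ => rfl
  have hρinj : Function.Injective ρ := by
    rw [injective_iff_map_eq_one]
    intro g hg
    refine h.eq_one g fun y => ?_
    have : ρ g ((y⁻¹ : G) : G ⧸ N) = ((y⁻¹ : G) : G ⧸ N) := by rw [hg]; rfl
    rw [hρ, eq_comm, QuotientGroup.eq] at this
    simpa [mul_assoc] using this
  have hswap : ∀ x ∈ A, ρ x = Equiv.swap ((1 : G) : G ⧸ N) (x : G) := by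
    intro x hx
    ext p
    rcases hrep p with rfl | ⟨y, hy, rfl⟩
    · rw [hρ, Equiv.swap_apply_left, mul_one]
    · rw [hρ]
      by_cases hxy : x = y
      · rw [← hxy, Equiv.swap_apply_right, (h.mul_self_and_notMem x hx).1]
      -- A third coset `yN` is fixed because `y⁻¹ * x * y = y * x * y` lies in `N`.
      · rw [Equiv.swap_apply_of_ne_of_ne (hne y hy).symm
          (fun e => hxy (hinj y hy x hx e).symm), eq_comm, QuotientGroup.eq, hinv y hy]
        simpa [mul_assoc] using h.mul_mul_mem y x hy hx (Ne.symm hxy)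
  have hbase : ∀ p : G ⧸ N, Equiv.swap ((1 : G) : G ⧸ N) p ∈ ρ.range := by
    intro p
    rcases hrep p with rfl | ⟨x, hx, rfl⟩
    · rw [Equiv.swap_self]
      exact one_mem _
    · exact ⟨x, hswap x hx⟩
  have hρsurj : Function.Surjective ρ := by
    rw [← MonoidHom.range_eq_top, eq_top_iff, ← Equiv.Perm.closure_isSwap,
      Subgroup.closure_le]
    rintro _ ⟨p, r, hpr, rfl⟩
    by_cases hp : p = ((1 : G) : G ⧸ N)
    · rw [hp]; exact hbase r
    by_cases hr : r = ((1 : G) : G ⧸ N)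
    · rw [hr, Equiv.swap_comm]; exact hbase p
    · rw [SetLike.mem_coe, ← Equiv.swap_mul_swap_mul_swap hr hpr.symm, Equiv.swap_comm r]
      exact mul_mem (mul_mem (hbase _) (hbase _)) (hbase _)
  exact ⟨(MulEquiv.ofBijective ρ ⟨hρinj, hρsurj⟩).trans
    ((e.symm.trans (finSuccEquiv m).symm).permCongrHom)⟩

end Recognition

/-! ### Symmetric groups satisfy the sentence -/

section Existence

variable {m : ℕ}

/-- The cyclic permutation of `ZMod m`, with one more point that is fixed. -/
def cyclePerm (m : ℕ) : Equiv.Perm (Option (ZMod m)) :=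
  Equiv.optionCongr (Equiv.addLeft 1)

lemma cyclePerm_pow_none (i : ℕ) : (cyclePerm m ^ i) none = none := by
  induction i with
  | zero => rfl
  | succ i ih => rw [pow_succ', Equiv.Perm.mul_apply, ih]; rfl

lemma cyclePerm_pow_some (i : ℕ) (j : ZMod m) : (cyclePerm m ^ i) (some j) = some (i + j) := by
  induction i with
  | zero => simp
  | succ i ih =>
    rw [pow_succ', Equiv.Perm.mul_apply, ih]
    change some (1 + ((i : ZMod m) + j)) = _
    push_cast
    ring_nf

lemma conj_swap {α : Type*} [DecidableEq α] (g : Equiv.Perm α) (x y : α) :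
    g * Equiv.swap x y * g⁻¹ = Equiv.swap (g x) (g y) := by
  rw [Equiv.swap_apply_apply]

lemma cyclePerm_pow_conj (i : ℕ) :
    cyclePerm m ^ i * Equiv.swap none (some 0) * (cyclePerm m ^ i)⁻¹ =
      Equiv.swap none (some (i : ZMod m)) := by
  rw [conj_swap, cyclePerm_pow_none, cyclePerm_pow_some, add_zero]

variable [NeZero m]

lemma mem_starSet_cyclePerm {x : Equiv.Perm (Option (ZMod m))} :
    x ∈ starSet (cyclePerm m) (Equiv.swap none (some 0)) m ↔
      ∃ i : ZMod m, x = Equiv.swap none (some i) := by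
  constructor
  · rintro ⟨i, -, rfl⟩
    exact ⟨i, cyclePerm_pow_conj i⟩
  · rintro ⟨i, rfl⟩
    exact ⟨i.val, i.val_lt, by rw [cyclePerm_pow_conj, ZMod.natCast_zmod_val]⟩

lemma swap_mem_starSet_cyclePerm {x y : Option (ZMod m)} (hxy : x ≠ y) :
    Equiv.swap x y ∈ starSet (cyclePerm m) (Equiv.swap none (some 0)) m ↔
      x = none ∨ y = none := by
  rw [mem_starSet_cyclePerm]
  constructor
  · rintro ⟨i, h⟩
    by_contra! hn
    have := congrArg (fun g => g none) h
    simp [Equiv.swap_apply_of_ne_of_ne hn.1.symm hn.2.symm] at this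
  · rintro (rfl | rfl)
    · obtain ⟨j, rfl⟩ := Option.ne_none_iff_exists'.1 hxy.symm
      exact ⟨j, rfl⟩
    · obtain ⟨j, rfl⟩ := Option.ne_none_iff_exists'.1 hxy
      exact ⟨j, Equiv.swap_comm _ _⟩

/-- If `g` moves `none`, each conjugated star transposition can stay in the star only if `g (some i)
= none`; two different `i` contradict injectivity. For `m = 1` this fails: the normalizer is all of
`S_2`. -/
lemma mem_setwiseNormalizer_cyclePerm (hm : 2 ≤ m) {g : Equiv.Perm (Option (ZMod m))} :
    g ∈ setwiseNormalizer (starSet (cyclePerm m) (Equiv.swap none (some 0)) m) ↔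
      g none = none := by
  have hm' : Fact (1 < m) := ⟨hm⟩
  constructor
  · intro hg
    by_contra hn
    have key (i : ZMod m) : g (some i) = none := by
      have h := (hg _).1 (mem_starSet_cyclePerm.2 ⟨i, rfl⟩)
      rw [conj_swap, swap_mem_starSet_cyclePerm (g.injective.ne (by simp))] at h
      exact h.resolve_left hn
    have := g.injective ((key 0).trans (key 1).symm)
    simp at this
  · intro hg
    have one_sided {g : Equiv.Perm (Option (ZMod m))} (hg : g none = none)
        {x : Equiv.Perm (Option (ZMod m))}
        (hx : x ∈ starSet (cyclePerm m) (Equiv.swap none (some 0)) m) :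
        g * x * g⁻¹ ∈ starSet (cyclePerm m) (Equiv.swap none (some 0)) m := by
      obtain ⟨i, rfl⟩ := mem_starSet_cyclePerm.1 hx
      rw [conj_swap, swap_mem_starSet_cyclePerm (g.injective.ne (by simp))]
      exact .inl hg
    refine fun x => ⟨one_sided hg, fun hx => ?_⟩
    have := one_sided (g := g⁻¹) (by rw [Equiv.Perm.inv_eq_iff_eq, hg]) hx
    simpa [mul_assoc] using this

lemma isTranspositionStar_cyclePerm (hm : 2 ≤ m) :
    IsTranspositionStar m (cyclePerm m) (Equiv.swap none (some 0)) where
  exists_mul_mem g := by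
    simp only [mem_setwiseNormalizer_cyclePerm hm]
    rcases h : g none with _ | i
    · exact .inl rfl
    · exact .inr ⟨_, mem_starSet_cyclePerm.2 ⟨i, rfl⟩, by simp [h]⟩
  mul_mul_mem x y hx hy hxy := by
    obtain ⟨i, rfl⟩ := mem_starSet_cyclePerm.1 hx
    obtain ⟨j, rfl⟩ := mem_starSet_cyclePerm.1 hy
    have hij : i ≠ j := by rintro rfl; exact hxy rfl
    rw [mem_setwiseNormalizer_cyclePerm hm]
    simp only [Equiv.Perm.mul_apply, Equiv.swap_apply_left]
    rw [Equiv.swap_apply_of_ne_of_ne (a := none) (b := some j) (by simp) (by simpa using hij),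
      Equiv.swap_apply_right]
  mul_self_and_notMem x hx := by
    obtain ⟨i, rfl⟩ := mem_starSet_cyclePerm.1 hx
    refine ⟨Equiv.swap_mul_self _ _, ?_⟩
    rw [mem_setwiseNormalizer_cyclePerm hm]
    simp
  eq_one h hh := by
    simp only [mem_setwiseNormalizer_cyclePerm hm] at hh
    ext1 x
    -- Conjugating by this swap brings `x` to the base point, so the hypothesis says that `h` fixes
    -- `x`.
    have := hh (Equiv.swap x none)
    simp only [Equiv.Perm.mul_apply, Equiv.swap_inv, Equiv.swap_apply_right] at this
    rw [Equiv.swap_apply_eq_iff, Equiv.swap_apply_right] at this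
    exact this
  conj_ne x hx e := by
    obtain ⟨i, hi, rfl⟩ := hx
    -- A return to `a` after `i + 1` steps would make `m` divide `i + 1 < m`.
    have h : cyclePerm m ^ (i + 1) * Equiv.swap none (some 0) * (cyclePerm m ^ (i + 1))⁻¹ =
        Equiv.swap none (some 0) := by
      rw [pow_succ', mul_inv_rev]
      simpa only [mul_assoc] using e
    rw [cyclePerm_pow_conj] at h
    have h' := congrArg (fun g => g none) h
    simp only [Equiv.swap_apply_left, Option.some.injEq] at h'
    rw [ZMod.natCast_eq_zero_iff] at h'
    exact absurd (Nat.le_of_dvd (by omega) h') (by omega)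

end Existence

/-! ### The class of symmetric groups -/

/-- Isomorphic groups are isomorphic as structures for the language of groups. -/
def MulEquiv.toGroupLanguageEquiv {G : Type u} {H : Type v} [Group G] [Group H] (e : G ≃* H) :
    groupLanguage.Equiv G H where
  toEquiv := e.toEquiv
  map_fun' f x := by
    cases f
    · exact e.map_one
    · exact e.map_inv _
    · exact e.map_mul _ _
  map_rel' r := Empty.elim r

lemma realize_sentence_iff_of_mulEquiv {G : Type u} {H : Type v} [Group G] [Group H] (e : G ≃* H)
    (ψ : groupLanguage.Sentence) : G ⊨ ψ ↔ H ⊨ ψ :=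
  StrongHomClass.realize_sentence e.toGroupLanguageEquiv ψ

lemma describesGroup_symmetricSentence {H : Type u} [Group H] {q : ℕ}
    (e : H ≃* Equiv.Perm (Fin (q + 3))) : DescribesGroup (symmetricSentence q) H := by
  constructor
  -- `ZMod (q + 2)` unfolds to `Fin (q + 2)`.
  · let f : Fin (q + 3) ≃ Option (ZMod (q + 2)) := finSuccEquiv (q + 2)
    rw [realize_sentence_iff_of_mulEquiv (e.trans f.permCongrHom), realize_symmetricSentence]
    exact ⟨_, _, isTranspositionStar_cyclePerm (by omega)⟩
  · intro G _ hG
    obtain ⟨c, a, h⟩ := (realize_symmetricSentence q).1 hG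
    obtain ⟨e'⟩ := h.nonempty_mulEquiv
    exact ⟨e'.trans e.symm⟩

/-- The sentence expressing that every element is the identity. -/
def trivialSentence : groupLanguage.Sentence := ∀' (&0 =' oneTerm)

lemma describesGroup_trivialSentence {H : Type u} [Group H] [Subsingleton H] :
    DescribesGroup trivialSentence H := by
  have h (G : Type u) [Group G] : G ⊨ trivialSentence ↔ ∀ g : G, g = 1 := by
    simp [trivialSentence, FirstOrder.Language.Sentence.Realize,
      FirstOrder.Language.Formula.Realize]
    rfl
  refine ⟨(h H).2 fun g => Subsingleton.elim _ _, fun G _ hG => ?_⟩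
  rw [h] at hG
  have : Subsingleton G := ⟨fun x y => (hG x).trans (hG y).symm⟩
  have : Unique G := ⟨⟨1⟩, hG⟩
  have : Unique H := ⟨⟨1⟩, fun _ => Subsingleton.elim _ _⟩
  exact ⟨MulEquiv.ofUnique⟩

/-- The sentence expressing that there are exactly two elements. -/
def orderTwoSentence : groupLanguage.Sentence :=
  ∃' (∼(&0 =' oneTerm) ⊓ ∀' ((&1 =' oneTerm) ⊔ (&1 =' &0)))

lemma describesGroup_orderTwoSentence {H : Type u} [Group H] (hH : Nat.card H = 2) :
    DescribesGroup orderTwoSentence H := by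
  have h (G : Type u) [Group G] :
      G ⊨ orderTwoSentence ↔ ∃ a : G, a ≠ 1 ∧ ∀ g : G, g = 1 ∨ g = a := by
    simp [orderTwoSentence, FirstOrder.Language.Sentence.Realize,
      FirstOrder.Language.Formula.Realize]
    rfl
  constructor
  · rw [h]
    obtain ⟨x, y, hxy, hu⟩ := Nat.card_eq_two_iff.1 hH
    have hu' (g : H) : g = x ∨ g = y := by
      have : g ∈ ({x, y} : Set H) := hu ▸ Set.mem_univ g
      simpa using this
    rcases hu' 1 with h1 | h1
    · exact ⟨y, h1 ▸ hxy.symm, fun g => h1 ▸ hu' g⟩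
    · exact ⟨x, h1 ▸ hxy, fun g => h1 ▸ (hu' g).symm⟩
  · intro G _ hG
    obtain ⟨a, ha, hu⟩ := (h G).1 hG
    have hG2 : Nat.card G = 2 := Nat.card_eq_two_iff.2 ⟨1, a, ha.symm, by
      ext g; simpa using hu g⟩
    exact ⟨mulEquivOfPrimeCardEq (p := 2) hG2 hH⟩

lemma two_pow_le_factorial_succ (n : ℕ) : 2 ^ n ≤ (n + 1).factorial := by
  induction n with
  | zero => simp
  | succ n ih =>
    rw [pow_succ', Nat.factorial_succ]
    exact Nat.mul_le_mul (by omega) ih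

theorem mainTheorem3 : LogCompressible.{u} IsSymmetricGroup.{u} := by
  have hcard {H : Type u} [Group H] {n : ℕ} (e : H ≃* Equiv.Perm (Fin n)) :
      Nat.card H = n.factorial := by
    rw [Nat.card_congr e.toEquiv, Nat.card_perm, Nat.card_fin]
  have hlog : 0 < Real.log 2 := Real.log_pos one_lt_two
  -- The sentence for degree `q + 3` has length at most `2000 * (q + 2)`, and `(q + 3)! ≥ 2 ^ (q +
  -- 2)`; the constant is the quotient.
  refine ⟨fun H _ ⟨n, ⟨e⟩⟩ => Finite.of_equiv _ e.symm.toEquiv, 2000 / Real.log 2, ?_⟩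
  rintro H _ ⟨n, ⟨e⟩⟩
  have hn := hcard e
  rcases n with _ | _ | _ | q
  · have := (Nat.card_eq_one_iff_unique.1 hn).1
    exact ⟨_, describesGroup_trivialSentence, fun h => absurd hn (by simpa using h.ne')⟩
  · have := (Nat.card_eq_one_iff_unique.1 hn).1
    exact ⟨_, describesGroup_trivialSentence, fun h => absurd hn (by simpa using h.ne')⟩
  · refine ⟨_, describesGroup_orderTwoSentence hn, fun _ => ?_⟩
    have hl : formulaLength orderTwoSentence ≤ 2000 := by
      simp [orderTwoSentence]
    rw [hn]
    simp only [zero_add, Nat.reduceAdd, Nat.factorial_two, Nat.cast_ofNat, pow_one]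
    rw [div_mul_cancel₀ _ hlog.ne']
    exact_mod_cast hl
  · refine ⟨_, describesGroup_symmetricSentence e, fun _ => ?_⟩
    rw [hn, pow_one]
    have h₁ : ((q + 2 : ℕ) : ℝ) * Real.log 2 ≤ Real.log ((q + 3).factorial : ℕ) := by
      rw [← Real.log_pow]
      exact Real.log_le_log (by positivity) (by exact_mod_cast two_pow_le_factorial_succ (q + 2))
    have h₂ : (formulaLength (symmetricSentence q) : ℝ) ≤ 2000 * ((q + 2 : ℕ) : ℝ) := by
      exact_mod_cast formulaLength_symmetricSentence_le q
    calc (formulaLength (symmetricSentence q) : ℝ) ≤ 2000 * ((q + 2 : ℕ) : ℝ) := h₂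
      _ = 2000 / Real.log 2 * (((q + 2 : ℕ) : ℝ) * Real.log 2) := by field_simp
      _ ≤ 2000 / Real.log 2 * Real.log ((q + 3).factorial : ℕ) := by gcongr
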